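/- Let $G=(I\sqcup J,E)$ be a finite bipartite graph in which every vertex $v$ has a linear order $<_v$ on the set $\delta(v)$ of its incident edges ($e<_v e'$ means that $v$ prefers $e$ to $e'$). A matching $M\subseteq E$ is stable if no edge $e\in E\setminus M$ blocks it, i.e. there is no $e\in E\setminus M$ such that each endpoint $v$ of $e$ is either uncovered by $M$ or satisfies $e<_v e'$ for the edge $e'\in M$ at $v$. Let $M_{\min}$ (resp. $M_{\max}$) be the stable matching that is best for $I$ and worst for $J$ (resp. worst for $I$ and best for $J$) among all stable matchings. For a stable matching $M$, an edge $a=mw\in E\setminus M$ ($m\in I$, $w\in J$) is admissible if $m$ is covered by an edge $e\in M$ with $e<_m a$, and $w$ is either uncovered or covered by an edge $e'\in M$ with $a<_w e'$. The most preferred admissible edge in $\delta(m)$, if there is one, is called active. The active graph $\Gamma(M)$ is formed by the edges of $M$ and the active edges for $M$. A rotation for $M$ is a cycle $C$ of $\Gamma(M)$; its edges in $M$ are its matching edges, and the others are its active edges (this partition does not depend on the choice of $M$). A trace is a sequence of stable matchings $M_0=M_{\min},M_1,\dots,M_N=M_{\max}$ in which each $M_i$ equals $M_{i-1}\triangle C_i$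 for a rotation $C_i$ for $M_{i-1}$; its sequence of rotations is $C_1,\dots,C_N$. Let $\mathcal R_G$ be the set of all rotations occurring in traces. For $C,D\in\mathcal R_G$ write $C\lessdot D$ if in every trace $C$ occurs earlier than $D$. Let $H$ be the digraph with vertex set $\mathcal R_G$ whose arcs are the pairs $(C,D)$ such that (i) $C$ and $D$ have a common vertex and $C\lessdot D$; or (ii) $C$ contains a matching edge $e=mw$ and an active edge $a=vw$, $D$ contains a matching edge $e'=m'w'$ and an active edge $a'=m'w''$ (with $m,v,m'\in I$ and $w,w',w''\in J$), and $b=m'w$ is an edge of $G$ that belongs to no rotation in $\mathcal R_G$ and satisfies $e'<_{m'}b<_{m'}a'$ and $a<_w b<_w e$. Then for all $C,D\in\mathcal R_G$: $C\lessdot D$ if and only if $H$ has a directed path with at least one arc from $C$ to $D$. Consequently, $C=D$ or $C\lessdot D$ if and only if $D$ is reachable from $C$ in $H$ by a directed path, possibly trivial; that is, the reachability order of $H$ coincides with the rotation poset order. -/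

import Mathlib

namespace RotPoset

/-- The pair `e = (m, w)`, viewed as the edge `mw`, is incident to the vertex `v`. The vertex set of
the bipartite graph is the disjoint union `I ⊕ J`. -/
def Inc {I J : Type*} (e : I × J) : I ⊕ J → Prop
  | Sum.inl m => e.1 = m
  | Sum.inr w => e.2 = w

/-- A bipartite graph with colour classes `I` ("men") and `J` ("women"), edge set `E ⊆ I × J`, in
which every vertex `v` has a linear order `lt v` on the set of edges incident to `v`.
`lt v e e'` means that `v` prefers `e` to `e'`. -/
structure PrefGraph (I J : Type*) where
  E : Set (I × J)
  lt : I ⊕ J → I × J → I × J → Prop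
  linear : ∀ v : I ⊕ J,
    IsStrictTotalOrder {e : I × J // e ∈ E ∧ Inc e v} (fun e e' => lt v e.1 e'.1)

/-- The vertex `v` is covered by the edge set `M`. -/
def Covered {I J : Type*} (M : Set (I × J)) (v : I ⊕ J) : Prop :=
  ∃ e ∈ M, Inc e v

namespace PrefGraph

variable {I J : Type*} (G : PrefGraph I J)

/-- A set of edges no two of which share a vertex. -/
def IsMatching (M : Set (I × J)) : Prop :=
  M ⊆ G.E ∧ ∀ e ∈ M, ∀ e' ∈ M, ∀ v, Inc e v → Inc e' v → e = e'

/-- The edge `e ∉ M` blocks `M`: each endpoint is uncovered by `M` or prefers `e` to its edge of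
`M`. -/
def Blocks (e : I × J) (M : Set (I × J)) : Prop :=
  e ∈ G.E ∧ e ∉ M ∧ ∀ v, Inc e v → (¬ Covered M v ∨ ∃ e' ∈ M, Inc e' v ∧ G.lt v e e')

/-- Stable matchings. -/
def IsStable (M : Set (I × J)) : Prop :=
  G.IsMatching M ∧ ∀ e, ¬ G.Blocks e M

/-- `e ≤_v e'`. -/
def le (v : I ⊕ J) (e e' : I × J) : Prop := e = e' ∨ G.lt v e e'

/-- `M` is the stable matching `M_min`: it is best for the vertices in `I` and worst for the vertices
in `J` among all stable matchings. -/
def IsMin (M : Set (I × J)) : Prop :=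
  G.IsStable M ∧ ∀ L, G.IsStable L → ∀ e ∈ M, ∀ e' ∈ L,
    (∀ m, Inc e (Sum.inl m) → Inc e' (Sum.inl m) → G.le (Sum.inl m) e e') ∧
    (∀ w, Inc e (Sum.inr w) → Inc e' (Sum.inr w) → G.le (Sum.inr w) e' e)

/-- `M` is the stable matching `M_max`: it is worst for the vertices in `I` and best for the vertices
in `J` among all stable matchings. -/
def IsMax (M : Set (I × J)) : Prop :=
  G.IsStable M ∧ ∀ L, G.IsStable L → ∀ e ∈ M, ∀ e' ∈ L,
    (∀ m, Inc e (Sum.inl m) → Inc e' (Sum.inl m) → G.le (Sum.inl m) e' e) ∧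
    (∀ w, Inc e (Sum.inr w) → Inc e' (Sum.inr w) → G.le (Sum.inr w) e e')

/-- The edge `a = mw ∉ M` is admissible for `M`: `m` is covered and prefers its edge of `M` to `a`,
while `w` is uncovered or prefers `a` to its edge of `M`. -/
def Admissible (M : Set (I × J)) (a : I × J) : Prop :=
  a ∈ G.E ∧ a ∉ M ∧
    (∃ e ∈ M, Inc e (Sum.inl a.1) ∧ G.lt (Sum.inl a.1) e a) ∧
    (¬ Covered M (Sum.inr a.2) ∨
      ∃ e' ∈ M, Inc e' (Sum.inr a.2) ∧ G.lt (Sum.inr a.2) a e')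

/-- The edge `a = mw` is active for `M`: it is the most preferred one among the admissible edges
at `m`. -/
def Active (M : Set (I × J)) (a : I × J) : Prop :=
  G.Admissible M a ∧
    ∀ a', G.Admissible M a' → a'.1 = a.1 → G.le (Sum.inl a.1) a a'

/-- The active graph `Γ(M)`, formed by the edges of `M` and the active edges for `M`
(isolated vertices are irrelevant here). -/
def activeGraph (M : Set (I × J)) : SimpleGraph (I ⊕ J) :=
  SimpleGraph.fromRel fun u v =>
    ∃ e : I × J, u = Sum.inl e.1 ∧ v = Sum.inr e.2 ∧ (e ∈ M ∨ G.Active M e)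

/-- `C` is a rotation for `M`: the edge set of a cycle of the active graph `Γ(M)`. -/
def IsRotationFor (M C : Set (I × J)) : Prop :=
  ∃ (v : I ⊕ J) (p : (G.activeGraph M).Walk v v), p.IsCycle ∧
    C = {e | s(Sum.inl e.1, Sum.inr e.2) ∈ p.edges}

/-- `(M 0, …, M N)` is a trace with the sequence of rotations `(C 0, …, C (N - 1))`: the stable
matchings lead from `M_min` to `M_max`, and each is obtained from the previous one by exchanging the
edges along one rotation for it. -/
def IsTrace (N : ℕ) (M : Fin (N + 1) → Set (I × J)) (C : Fin N → Set (I × J)) : Prop :=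
  G.IsMin (M 0) ∧ G.IsMax (M (Fin.last N)) ∧ (∀ i, G.IsStable (M i)) ∧
    ∀ i : Fin N, G.IsRotationFor (M i.castSucc) (C i) ∧
      M i.succ = (M i.castSucc \ C i) ∪ (C i \ M i.castSucc)

/-- The set `R_G` of the rotations that occur in traces. -/
def rotations : Set (Set (I × J)) :=
  {X | ∃ N M C, G.IsTrace N M C ∧ ∃ i, C i = X}

/-- `X ⋖ Y`: in every trace, `X` occurs earlier than `Y`. -/
def Precedes (X Y : G.rotations) : Prop :=
  ∀ N M C, G.IsTrace N M C → ∃ i j : Fin N, i < j ∧ C i = X.1 ∧ C j = Y.1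

/-- `e` is a matching edge of the rotation `X`: it lies in `X` and in a stable matching for which `X`
is a rotation. -/
def MatchingEdge (X : Set (I × J)) (e : I × J) : Prop :=
  e ∈ X ∧ ∃ M, G.IsStable M ∧ G.IsRotationFor M X ∧ e ∈ M

/-- `a` is an active edge of the rotation `X`: it lies in `X`, but not in a stable matching for which
`X` is a rotation. -/
def ActiveEdge (X : Set (I × J)) (a : I × J) : Prop :=
  a ∈ X ∧ ∃ M, G.IsStable M ∧ G.IsRotationFor M X ∧ a ∉ M

/-- The rotations `X` and `Y` have a common vertex. -/
def ShareVertex (X Y : Set (I × J)) : Prop :=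
  ∃ v, Covered X v ∧ Covered Y v

/-- The local condition on a pair `(X, Y)` of rotations that need not share a vertex: `X` has a
matching edge `e = mw` and an active edge `a = vw`, `Y` has a matching edge `e' = m'w'` and an active
edge `a' = m'w''`, and there is an edge `b = m'w` of the graph, not contained in any rotation, such
that `b` lies between `e'` and `a'` in the order at `m'` and between `a` and `e` in the order
at `w`. -/
def LocalCondition (X Y : Set (I × J)) : Prop :=
  ∃ (m v m' : I) (w w' w'' : J),
    G.MatchingEdge X (m, w) ∧ G.ActiveEdge X (v, w) ∧
    G.MatchingEdge Y (m', w') ∧ G.ActiveEdge Y (m', w'') ∧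
    (m', w) ∈ G.E ∧ (∀ Z ∈ G.rotations, (m', w) ∉ Z) ∧
    G.lt (Sum.inl m') (m', w') (m', w) ∧ G.lt (Sum.inl m') (m', w) (m', w'') ∧
    G.lt (Sum.inr w) (v, w) (m', w) ∧ G.lt (Sum.inr w) (m', w) (m, w)

/-- The digraph `H` on the set of rotations. -/
def rotationDigraph : Digraph G.rotations where
  Adj X Y := (ShareVertex X.1 Y.1 ∧ G.Precedes X Y) ∨ G.LocalCondition X.1 Y.1

end PrefGraph

end RotPoset

/-! Along a trace no vertex of `I` ever gains and no vertex of `J` ever loses, so at a shared vertex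
the preferences dictate the order of two rotations, the same one in every trace. All traces use the
same rotations, each once: distinct rotations for one matching are disjoint, each survives the
exchange along the other, and the exchanges commute (`IsRotationFor.symmDiff`, `Chain.erase`,
`Chain.perm`).

Every arc of $H$ is a forced order. For type (i) this is the definition. For type (ii), if $D$ came
no later than $C$, then $w$ would still hold an edge no better than $e$ when $D$ is applied; so $b$
would be admissible and better for $m'$ than the active edge $a'$ (`LocalCondition.precedes`).

Conversely, consecutive rotations $C, D$ of a trace without an arc can be exchanged
(`IsTraceList.swap`). They are disjoint, so only one thing can go wrong: $D$ is not yet a rotation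
before $C$ is applied. Then some edge $b = m'w$, better than the active edge of $D$ at $m'$, was
admissible before $C$ and is spoiled because $C$ improves $w$; this is the local condition
(`IsRotationFor.of_symmDiff_or_exists`). By such exchanges any trace can be sorted so that the
rotations from which $D$ is reachable come first. If $C \lessdot D$, then $C$ is still ahead of $D$
there, hence $D$ is reachable from $C$. -/

namespace RotPoset

namespace PrefGraph

open scoped symmDiff

variable {I J : Type*} {G : PrefGraph I J}

/-! ### Preference orders, uniqueness of matching and active edges -/

theorem lt_trans {v : I ⊕ J} {a b c : I × J} (ha : a ∈ G.E) (hb : b ∈ G.E) (hc : c ∈ G.E)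
    (va : Inc a v) (vb : Inc b v) (vc : Inc c v) (hab : G.lt v a b) (hbc : G.lt v b c) :
    G.lt v a c :=
  (G.linear v).toIsTrans.trans ⟨a, ha, va⟩ ⟨b, hb, vb⟩ ⟨c, hc, vc⟩ hab hbc

theorem lt_irrefl {v : I ⊕ J} {a : I × J} (ha : a ∈ G.E) (va : Inc a v) : ¬ G.lt v a a :=
  (G.linear v).toIrrefl.irrefl ⟨a, ha, va⟩

theorem lt_asymm {v : I ⊕ J} {a b : I × J} (ha : a ∈ G.E) (hb : b ∈ G.E)
    (va : Inc a v) (vb : Inc b v) (hab : G.lt v a b) : ¬ G.lt v b a := fun h =>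
  lt_irrefl ha va (lt_trans ha hb ha va vb va hab h)

theorem lt_total {v : I ⊕ J} {a b : I × J} (ha : a ∈ G.E) (hb : b ∈ G.E)
    (va : Inc a v) (vb : Inc b v) : G.le v a b ∨ G.lt v b a := by
  by_contra! h
  have := (G.linear v).toTrichotomous.trichotomous ⟨a, ha, va⟩ ⟨b, hb, vb⟩
    (fun h' => h.1 (Or.inr h')) h.2
  exact h.1 (Or.inl (congrArg Subtype.val this))

theorem le_trans {v : I ⊕ J} {a b c : I × J} (ha : a ∈ G.E) (hb : b ∈ G.E) (hc : c ∈ G.E)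
    (va : Inc a v) (vb : Inc b v) (vc : Inc c v) (hab : G.le v a b) (hbc : G.le v b c) :
    G.le v a c := by
  rcases hab with rfl | hab
  · exact hbc
  · rcases hbc with rfl | hbc
    · exact Or.inr hab
    · exact Or.inr (lt_trans ha hb hc va vb vc hab hbc)

theorem not_lt_of_le {v : I ⊕ J} {a b : I × J} (ha : a ∈ G.E) (hb : b ∈ G.E)
    (va : Inc a v) (vb : Inc b v) (hab : G.le v a b) : ¬ G.lt v b a := by
  rcases hab with rfl | hab
  · exact lt_irrefl ha va
  · exact lt_asymm ha hb va vb hab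

theorem lt_of_lt_of_le {v : I ⊕ J} {a b c : I × J} (ha : a ∈ G.E) (hb : b ∈ G.E) (hc : c ∈ G.E)
    (va : Inc a v) (vb : Inc b v) (vc : Inc c v) (hab : G.lt v a b) (hbc : G.le v b c) :
    G.lt v a c := by
  rcases hbc with rfl | hbc
  · exact hab
  · exact lt_trans ha hb hc va vb vc hab hbc

theorem IsMatching.right_unique {M : Set (I × J)} (hM : G.IsMatching M) {m : I} {w w' : J}
    (h : (m, w) ∈ M) (h' : (m, w') ∈ M) : w = w' :=
  congrArg Prod.snd (hM.2 _ h _ h' (Sum.inl m) rfl rfl)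

theorem IsMatching.left_unique {M : Set (I × J)} (hM : G.IsMatching M) {m m' : I} {w : J}
    (h : (m, w) ∈ M) (h' : (m', w) ∈ M) : m = m' :=
  congrArg Prod.fst (hM.2 _ h _ h' (Sum.inr w) rfl rfl)

theorem Active.right_unique {M : Set (I × J)} {m : I} {w w' : J}
    (h : G.Active M (m, w)) (h' : G.Active M (m, w')) : w = w' := by
  have h1 := h.2 _ h'.1 rfl
  have h2 := h'.2 _ h.1 rfl
  rcases h1 with h1 | h1
  · exact congrArg Prod.snd h1
  · exact absurd h1 (not_lt_of_le h'.1.1 h.1.1 rfl rfl h2)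

theorem covered_inl {M : Set (I × J)} {m : I} : Covered M (Sum.inl m) ↔ ∃ w, (m, w) ∈ M := by
  constructor
  · rintro ⟨⟨_, w⟩, h, rfl⟩
    exact ⟨w, h⟩
  · rintro ⟨w, h⟩
    exact ⟨_, h, rfl⟩

theorem covered_inr {M : Set (I × J)} {w : J} : Covered M (Sum.inr w) ↔ ∃ m, (m, w) ∈ M := by
  constructor
  · rintro ⟨⟨m, _⟩, h, rfl⟩
    exact ⟨m, h⟩
  · rintro ⟨w, h⟩
    exact ⟨_, h, rfl⟩

/-! ### Cycles of the active graph -/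

theorem activeGraph_adj_iff {M : Set (I × J)} {m : I} {w : J} :
    (G.activeGraph M).Adj (Sum.inl m) (Sum.inr w) ↔ ((m, w) ∈ M ∨ G.Active M (m, w)) := by
  simp [activeGraph]

theorem activeGraph_adj {M : Set (I × J)} {u v : I ⊕ J} (h : (G.activeGraph M).Adj u v) :
    ∃ e : I × J, s(u, v) = s(Sum.inl e.1, Sum.inr e.2) ∧ (e ∈ M ∨ G.Active M e) := by
  rw [activeGraph, SimpleGraph.fromRel_adj] at h
  rcases h.2 with ⟨e, rfl, rfl, he⟩ | ⟨e, rfl, rfl, he⟩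
  · exact ⟨e, rfl, he⟩
  · exact ⟨e, Sym2.eq_swap, he⟩

/-- The same cycle is a rotation for `M'` if its edges belong to the active graph of `M'`. -/
theorem IsRotationFor.transfer {M M' C : Set (I × J)} (h : G.IsRotationFor M C)
    (h' : ∀ e ∈ C, e ∈ M' ∨ G.Active M' e) : G.IsRotationFor M' C := by
  obtain ⟨v, p, hp, rfl⟩ := h
  have key : ∀ e ∈ p.edges, e ∈ (G.activeGraph M').edgeSet := by
    intro e he
    induction e with | _ x y =>
    obtain ⟨e, hxy, -⟩ := activeGraph_adj (p.adj_of_mem_edges he)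
    rw [hxy] at he ⊢
    exact activeGraph_adj_iff.2 (h' e he)
  exact ⟨v, p.transfer _ key, hp.transfer key, by rw [SimpleGraph.Walk.edges_transfer]⟩

theorem IsRotationFor.mem_or_active {M C : Set (I × J)} (h : G.IsRotationFor M C)
    {e : I × J} (he : e ∈ C) : e ∈ M ∨ G.Active M e := by
  obtain ⟨v, p, hp, rfl⟩ := h
  exact activeGraph_adj_iff.1 (p.adj_of_mem_edges he)

theorem IsRotationFor.nonempty {M C : Set (I × J)} (h : G.IsRotationFor M C) :
    ∃ m w, (m, w) ∈ C := by
  obtain ⟨v, p, hp, rfl⟩ := h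
  cases p with
  | nil => exact absurd rfl hp.ne_nil
  | cons h q =>
    obtain ⟨e, hxy, -⟩ := activeGraph_adj h
    refine ⟨e.1, e.2, ?_⟩
    rw [Set.mem_ofPred_eq, ← hxy, SimpleGraph.Walk.edges_cons]
    exact List.mem_cons_self

theorem IsRotationFor.ncard_right {M C : Set (I × J)} (h : G.IsRotationFor M C)
    {m : I} (hm : Covered C (Sum.inl m)) : {w | (m, w) ∈ C}.ncard = 2 := by
  obtain ⟨v, p, hp, rfl⟩ := h
  obtain ⟨w, hw⟩ := covered_inl.1 hm
  rw [← hp.ncard_neighborSet_toSubgraph_eq_two (p.fst_mem_support_of_mem_edges hw),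
    ← Set.ncard_image_of_injective _ (Sum.inr_injective (α := I))]
  congr 1
  ext (m' | w')
  · simp only [Set.mem_image, reduceCtorEq, and_false, exists_false, false_iff]
    intro h
    have := activeGraph_adj (p.toSubgraph.adj_sub h)
    simp at this
  · simp [SimpleGraph.Walk.adj_toSubgraph_iff_mem_edges]

theorem IsRotationFor.ncard_left {M C : Set (I × J)} (h : G.IsRotationFor M C)
    {w : J} (hw : Covered C (Sum.inr w)) : {m | (m, w) ∈ C}.ncard = 2 := by
  obtain ⟨v, p, hp, rfl⟩ := h
  obtain ⟨m, hm⟩ := covered_inr.1 hw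
  rw [← hp.ncard_neighborSet_toSubgraph_eq_two (p.snd_mem_support_of_mem_edges hm),
    ← Set.ncard_image_of_injective _ (Sum.inl_injective (β := J))]
  congr 1
  ext (m' | w')
  · simp [SimpleGraph.Walk.adj_toSubgraph_iff_mem_edges, Sym2.eq_swap]
  · simp only [Set.mem_image, reduceCtorEq, and_false, exists_false, false_iff]
    intro h
    have := activeGraph_adj (p.toSubgraph.adj_sub h)
    simp at this

/-- At each vertex of `I` a rotation has one edge of the matching and one active edge. -/
theorem IsRotationFor.exists_edges_left {M C : Set (I × J)} (h : G.IsRotationFor M C)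
    (hM : G.IsMatching M) {m : I} (hm : Covered C (Sum.inl m)) :
    ∃ w w', ((m, w) ∈ C ∧ (m, w) ∈ M) ∧ (m, w') ∈ C ∧ G.Active M (m, w') := by
  obtain ⟨w₁, w₂, hne, heq⟩ := Set.ncard_eq_two.1 (h.ncard_right hm)
  have h₁ : (m, w₁) ∈ C := by
    have : w₁ ∈ ({w₁, w₂} : Set J) := by simp
    rwa [← heq] at this
  have h₂ : (m, w₂) ∈ C := by
    have : w₂ ∈ ({w₁, w₂} : Set J) := by simp
    rwa [← heq] at this
  rcases h.mem_or_active h₁ with a₁ | a₁ <;> rcases h.mem_or_active h₂ with a₂ | a₂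
  · exact absurd (hM.right_unique a₁ a₂) hne
  · exact ⟨w₁, w₂, ⟨h₁, a₁⟩, h₂, a₂⟩
  · exact ⟨w₂, w₁, ⟨h₂, a₂⟩, h₁, a₁⟩
  · exact absurd (a₁.right_unique a₂) hne

/-- At a vertex of `J` two active edges could a priori meet. Double counting excludes this: all
degrees in `C` are two, so `C` covers equally many vertices on both sides, and the injection given
by the matching edges is onto. -/
theorem IsRotationFor.exists_matching_right [Finite I] [Finite J] {M C : Set (I × J)}
    (h : G.IsRotationFor M C) (hM : G.IsMatching M) {w : J} (hw : Covered C (Sum.inr w)) :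
    ∃ m, (m, w) ∈ C ∧ (m, w) ∈ M := by
  classical
  cases nonempty_fintype I
  cases nonempty_fintype J
  let R : Finset I := {m | Covered C (Sum.inl m)}
  let W : Finset J := {w | Covered C (Sum.inr w)}
  have hcard : R.card = W.card := by
    have := Finset.card_mul_eq_card_mul (s := R) (t := W) (m := 2) (n := 2)
      (fun m w => (m, w) ∈ C) ?_ ?_
    · omega
    · intro m hm
      rw [← h.ncard_right (m := m) (by simpa [R] using hm), ← Set.ncard_coe_finset]
      congr 1
      ext w
      simp only [Finset.bipartiteAbove, W, Finset.coe_filter, Finset.mem_filter, Finset.mem_univ,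
        true_and, Set.mem_ofPred_eq, and_iff_right_iff_imp]
      exact fun h => covered_inr.2 ⟨m, h⟩
    · intro w hw
      rw [← h.ncard_left (w := w) (by simpa [W] using hw), ← Set.ncard_coe_finset]
      congr 1
      ext m
      simp only [Finset.bipartiteBelow, R, Finset.coe_filter, Finset.mem_filter, Finset.mem_univ,
        true_and, Set.mem_ofPred_eq, and_iff_right_iff_imp]
      exact fun h => covered_inl.2 ⟨w, h⟩
  have hR : ∀ m ∈ R, ∃ w, (m, w) ∈ C ∧ (m, w) ∈ M := fun m hm => by
    obtain ⟨w, -, hw, -⟩ := h.exists_edges_left hM (m := m) (by simpa [R] using hm)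
    exact ⟨w, hw⟩
  choose f hf using hR
  obtain ⟨m, hm, rfl⟩ := Finset.surj_on_of_inj_on_of_card_le (s := R) (t := W) f
    (fun m hm => by simpa [W] using covered_inr.2 ⟨m, (hf m hm).1⟩)
    (fun m m' hm hm' e => hM.left_unique (hf m hm).2 (e ▸ (hf m' hm').2)) hcard.ge w
    (by simpa [W] using hw)
  exact ⟨m, hf m hm⟩

/-- At each vertex of `J` a rotation has one edge of the matching and one active edge. -/
theorem IsRotationFor.exists_edges_right [Finite I] [Finite J] {M C : Set (I × J)}
    (h : G.IsRotationFor M C) (hM : G.IsMatching M) {w : J} (hw : Covered C (Sum.inr w)) :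
    ∃ m m', ((m, w) ∈ C ∧ (m, w) ∈ M) ∧ ((m', w) ∈ C ∧ G.Active M (m', w)) ∧
      ∀ m'', (m'', w) ∈ C → m'' = m ∨ m'' = m' := by
  obtain ⟨m, hm⟩ := h.exists_matching_right hM hw
  obtain ⟨m₁, m₂, hne, heq⟩ := Set.ncard_eq_two.1 (h.ncard_left hw)
  have hall : ∀ m'', (m'', w) ∈ C ↔ m'' = m₁ ∨ m'' = m₂ := fun m'' => by
    have := Set.ext_iff.1 heq m''
    simpa using this
  have key : ∀ m', m' ≠ m → (m', w) ∈ C → G.Active M (m', w) := fun m' hne h' =>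
    (h.mem_or_active h').resolve_left fun h'' => hne (hM.left_unique h'' hm.2)
  rcases (hall m).1 hm.1 with rfl | rfl
  · have h2 := (hall m₂).2 (Or.inr rfl)
    exact ⟨m, m₂, hm, ⟨h2, key _ hne.symm h2⟩, fun m'' h => (hall _).1 h⟩
  · have h2 := (hall m₁).2 (Or.inl rfl)
    exact ⟨m, m₁, hm, ⟨h2, key _ hne h2⟩, fun m'' h => ((hall _).1 h).symm⟩

theorem IsRotationFor.left_unique [Finite I] [Finite J] {M C : Set (I × J)}
    (h : G.IsRotationFor M C) (hM : G.IsMatching M) {m m' : I} {w : J}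
    (hm : (m, w) ∈ C) (hmM : (m, w) ∉ M) (hm' : (m', w) ∈ C) (hmM' : (m', w) ∉ M) : m = m' := by
  obtain ⟨m₁, m₂, h₁, -, h₃⟩ := h.exists_edges_right hM (covered_inr.2 ⟨_, hm⟩)
  have := h₃ m hm
  have := h₃ m' hm'
  grind

theorem walk_induction {V : Type*} {H : SimpleGraph V} {P : V → Prop} {u v : V} (p : H.Walk u v)
    (hu : P u) (hP : ∀ x y, s(x, y) ∈ p.edges → P x → P y) : ∀ x ∈ p.support, P x := by
  induction p with
  | nil => simpa using hu
  | cons h q ih =>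
    intro x hx
    rw [SimpleGraph.Walk.support_cons, List.mem_cons] at hx
    rcases hx with rfl | hx
    · exact hu
    · exact ih (hP _ _ (by simp) hu) (fun x y hxy => hP x y (by simp [hxy])) x hx

/-- A cycle is connected: rotated so as to start at `m`, it carries the edge-invariant `P` to all
its vertices. -/
theorem IsRotationFor.walk_induction {M C : Set (I × J)} (h : G.IsRotationFor M C)
    {P : I ⊕ J → Prop} (hP : ∀ m w, (m, w) ∈ C → (P (Sum.inl m) ↔ P (Sum.inr w)))
    {m m' : I} (hm : Covered C (Sum.inl m)) (hm' : Covered C (Sum.inl m')) (hPm : P (Sum.inl m)) :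
    P (Sum.inl m') := by
  classical
  obtain ⟨v, p, hp, rfl⟩ := h
  obtain ⟨w, hw⟩ := covered_inl.1 hm
  obtain ⟨w', hw'⟩ := covered_inl.1 hm'
  have hs := p.fst_mem_support_of_mem_edges hw
  have hs' := p.fst_mem_support_of_mem_edges hw'
  refine PrefGraph.walk_induction (p.rotate _ hs) hPm ?_ _
    (SimpleGraph.Walk.fst_mem_support_of_mem_edges _
      ((p.rotate_edges _ hs).perm.mem_iff.2 hw'))
  intro x y hxy hx
  replace hxy := (p.rotate_edges _ hs).perm.mem_iff.1 hxy
  obtain ⟨e, he, -⟩ := activeGraph_adj (p.adj_of_mem_edges hxy)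
  rw [he] at hxy
  have := hP e.1 e.2 hxy
  rcases Sym2.eq_iff.1 he with ⟨rfl, rfl⟩ | ⟨rfl, rfl⟩
  · exact this.1 hx
  · exact this.2 hx

/-- A set of vertices of `I` that meets a rotation and is closed under going along an active edge
and back along a matching edge contains all vertices of the rotation in `I`. -/
theorem IsRotationFor.subset_of_closed [Finite I] [Finite J] {M C : Set (I × J)}
    (h : G.IsRotationFor M C) (hM : G.IsMatching M) {K : Set I}
    (hK : ∀ m ∈ K, ∀ m' w, (m, w) ∈ C → G.Active M (m, w) → (m', w) ∈ C → (m', w) ∈ M → m' ∈ K)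
    {m : I} (hm : m ∈ K) (hmC : Covered C (Sum.inl m)) {m' : I} (hm' : Covered C (Sum.inl m')) :
    m' ∈ K := by
  classical
  cases nonempty_fintype I
  let T : Finset I := {m | Covered C (Sum.inl m) ∧ m ∈ K}
  have hT : ∀ m, m ∈ T ↔ Covered C (Sum.inl m) ∧ m ∈ K := fun m => by simp [T]
  have hnext : ∀ m ∈ T, ∃ m' w, ((m, w) ∈ C ∧ G.Active M (m, w)) ∧ (m', w) ∈ C ∧ (m', w) ∈ M := by
    intro m hm
    obtain ⟨w, w', -, h'⟩ := h.exists_edges_left hM ((hT m).1 hm).1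
    obtain ⟨m', h''⟩ := h.exists_matching_right hM (covered_inr.2 ⟨m, h'.1⟩)
    exact ⟨m', w', h', h''⟩
  choose f g hf using hnext
  -- The step `f` is injective on the finite set `T`, hence onto. So `K` is also closed under the
  -- reverse step, which allows an undirected walk.
  have hsurj := Finset.surj_on_of_inj_on_of_card_le (s := T) (t := T) f
    (fun m hm => (hT _).2 ⟨covered_inl.2 ⟨_, (hf m hm).2.1⟩,
      hK m ((hT m).1 hm).2 _ _ (hf m hm).1.1 (hf m hm).1.2 (hf m hm).2.1 (hf m hm).2.2⟩)
    (fun m m' hm hm' e => by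
      have e' : g m hm = g m' hm' := hM.right_unique (hf m hm).2.2 (e ▸ (hf m' hm').2.2)
      refine h.left_unique hM (hf m hm).1.1 (hf m hm).1.2.1.2.1 (w := g m hm) ?_ ?_
      · exact e' ▸ (hf m' hm').1.1
      · exact e' ▸ (hf m' hm').1.2.1.2.1) le_rfl
  -- For vertices of `J` the invariant says that the matching edge of `C` there leads into `K`.
  refine h.walk_induction (P := Sum.elim (· ∈ K) (fun w => ∃ m ∈ K, (m, w) ∈ C ∧ (m, w) ∈ M))
    ?_ hmC hm' hm
  intro m w hmw
  obtain ⟨m₁, h₁⟩ := h.exists_matching_right hM (covered_inr.2 ⟨m, hmw⟩)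
  simp only [Sum.elim_inl, Sum.elim_inr]
  rcases h.mem_or_active hmw with hmM | hact
  · constructor
    · exact fun h => ⟨m, h, hmw, hmM⟩
    · rintro ⟨m', h', -, hm'M⟩
      rwa [hM.left_unique hmM hm'M]
  · constructor
    · exact fun h => ⟨m₁, hK m h _ _ hmw hact h₁.1 h₁.2, h₁⟩
    · rintro ⟨m', h', hC, hm'M⟩
      obtain ⟨m₂, hm₂, e⟩ := hsurj m' ((hT _).2 ⟨covered_inl.2 ⟨_, hC⟩, h'⟩)
      have h₂ := hf m₂ hm₂
      have e' : g m₂ hm₂ = w := hM.right_unique (e ▸ h₂.2.2) hm'M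
      have e'' : m = m₂ := h.left_unique hM hmw hact.1.2.1 (e' ▸ h₂.1.1) (e' ▸ h₂.1.2.1.2.1)
      rw [e'']
      exact ((hT _).1 hm₂).2

/-! ### Comparing edge sets: worse for `I`, better for `J` -/

theorem le_antisymm {v : I ⊕ J} {a b : I × J} (ha : a ∈ G.E) (hb : b ∈ G.E)
    (va : Inc a v) (vb : Inc b v) (hab : G.le v a b) (hba : G.le v b a) : a = b :=
  hab.resolve_right (not_lt_of_le hb ha vb va hba)

/-- At each common vertex in `I` (resp. `J`) all edges of `A` are at least as good (resp. bad) as all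
edges of `B`. -/
structure Before (G : PrefGraph I J) (A B : Set (I × J)) : Prop where
  left : ∀ {m w w'}, (m, w) ∈ A → (m, w') ∈ B → G.le (Sum.inl m) (m, w) (m, w')
  right : ∀ {w m m'}, (m, w) ∈ A → (m', w) ∈ B → G.le (Sum.inr w) (m', w) (m, w)

/-- `Before` is vacuous at a vertex missed by one of the sets, so it is not transitive by itself;
the middle set has to cover the vertices common to the outer ones. -/
theorem Before.trans {A B C : Set (I × J)} (hA : A ⊆ G.E) (hB : B ⊆ G.E) (hC : C ⊆ G.E)
    (hAB : G.Before A B) (hBC : G.Before B C)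
    (hcov : ∀ v, Covered A v → Covered C v → Covered B v) : G.Before A C := by
  constructor
  · intro m w w' h h'
    obtain ⟨w'', h''⟩ := covered_inl.1 (hcov _ (covered_inl.2 ⟨_, h⟩) (covered_inl.2 ⟨_, h'⟩))
    exact le_trans (hA h) (hB h'') (hC h') rfl rfl rfl (hAB.left h h'') (hBC.left h'' h')
  · intro w m m' h h'
    obtain ⟨m'', h''⟩ := covered_inr.1 (hcov _ (covered_inr.2 ⟨_, h⟩) (covered_inr.2 ⟨_, h'⟩))
    exact le_trans (hC h') (hB h'') (hA h) rfl rfl rfl (hBC.right h'' h') (hAB.right h h'')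

theorem IsMatching.before_self {M : Set (I × J)} (hM : G.IsMatching M) : G.Before M M where
  left h h' := Or.inl (by rw [hM.right_unique h h'])
  right h h' := Or.inl (by rw [hM.left_unique h h'])

theorem IsRotationFor.subset {M X : Set (I × J)} (h : G.IsRotationFor M X)
    (hM : G.IsMatching M) : X ⊆ G.E := fun _ he =>
  (h.mem_or_active he).elim (fun h => hM.1 h) (fun h => h.1.1)

theorem IsRotationFor.active {M X : Set (I × J)} (h : G.IsRotationFor M X) {e : I × J}
    (he : e ∈ X) (he' : e ∉ M) : G.Active M e :=
  (h.mem_or_active he).resolve_left he'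

theorem IsRotationFor.before {M X : Set (I × J)} (h : G.IsRotationFor M X)
    (hM : G.IsMatching M) : G.Before M X := by
  constructor
  · intro m w w' hw hw'
    rcases h.mem_or_active hw' with h' | ⟨⟨-, -, ⟨⟨m₁, w₁⟩, he, rfl, hlt⟩, -⟩, -⟩
    · exact hM.before_self.left hw h'
    · rw [hM.right_unique hw he]
      exact Or.inr hlt
  · intro w m m' hm hm'
    rcases h.mem_or_active hm' with h' | ⟨⟨-, -, -, h'⟩, -⟩
    · exact hM.before_self.right hm h'
    · rcases h' with h' | ⟨⟨m₁, w₁⟩, he, rfl, hlt⟩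
      · exact absurd (covered_inr.2 ⟨m, hm⟩) h'
      · rw [hM.left_unique hm he]
        exact Or.inr hlt

theorem mem_symmDiff_iff_left {M X Y : Set (I × J)} (h : ¬ ShareVertex X Y) {m : I} {w : J}
    (hX : Covered X (Sum.inl m)) : (m, w) ∈ M ∆ Y ↔ (m, w) ∈ M := by
  have : (m, w) ∉ Y := fun he => h ⟨_, hX, _, he, rfl⟩
  simp [Set.mem_symmDiff, this]

theorem mem_symmDiff_iff_right {M X Y : Set (I × J)} (h : ¬ ShareVertex X Y) {m : I} {w : J}
    (hX : Covered X (Sum.inr w)) : (m, w) ∈ M ∆ Y ↔ (m, w) ∈ M := by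
  have : (m, w) ∉ Y := fun he => h ⟨_, hX, _, he, rfl⟩
  simp [Set.mem_symmDiff, this]

theorem IsRotationFor.mem_of_covered_left {M X : Set (I × J)} (h : G.IsRotationFor M X)
    (hM : G.IsMatching M) {m : I} {w : J} (hm : Covered X (Sum.inl m)) (hw : (m, w) ∈ M) :
    (m, w) ∈ X := by
  obtain ⟨w₁, -, h₁, -⟩ := h.exists_edges_left hM hm
  rw [hM.right_unique hw h₁.2]
  exact h₁.1

theorem IsRotationFor.before_symmDiff {M X : Set (I × J)} (h : G.IsRotationFor M X)
    (hM : G.IsMatching M) : G.Before M (M ∆ X) := by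
  constructor
  · intro m w w' hw hw'
    rcases hw' with hw' | hw'
    · exact hM.before_self.left hw hw'.1
    · exact (h.before hM).left hw hw'.1
  · intro m w w' hw hw'
    rcases hw' with hw' | hw'
    · exact hM.before_self.right hw hw'.1
    · exact (h.before hM).right hw hw'.1

/-! ### Exchanging along a rotation -/

section Finite

variable [Finite I] [Finite J]

theorem IsRotationFor.mem_of_covered_right {M X : Set (I × J)} (h : G.IsRotationFor M X)
    (hM : G.IsMatching M) {m : I} {w : J} (hw : Covered X (Sum.inr w)) (hm : (m, w) ∈ M) :
    (m, w) ∈ X := by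
  obtain ⟨w₁, h₁⟩ := h.exists_matching_right hM hw
  rw [hM.left_unique hm h₁.2]
  exact h₁.1

theorem IsRotationFor.covered {M X : Set (I × J)} (h : G.IsRotationFor M X)
    (hM : G.IsMatching M) {v : I ⊕ J} (hv : Covered X v) :
    Covered M v ∧ Covered (M ∆ X) v := by
  rcases v with m | w
  · obtain ⟨w, w', h₁, h₂, h₃⟩ := h.exists_edges_left hM hv
    exact ⟨covered_inl.2 ⟨w, h₁.2⟩, covered_inl.2 ⟨w', Or.inr ⟨h₂, h₃.1.2.1⟩⟩⟩
  · obtain ⟨m, m', h₁, ⟨h₂, h₃⟩, -⟩ := h.exists_edges_right hM hv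
    exact ⟨covered_inr.2 ⟨m, h₁.2⟩, covered_inr.2 ⟨m', Or.inr ⟨h₂, h₃.1.2.1⟩⟩⟩

theorem IsRotationFor.covered_iff {M X : Set (I × J)} (h : G.IsRotationFor M X)
    (hM : G.IsMatching M) (v : I ⊕ J) : Covered M v ↔ Covered (M ∆ X) v := by
  by_cases hv : Covered X v
  · simp [h.covered hM hv]
  · constructor
    · rintro ⟨e, he, hev⟩
      exact ⟨e, Or.inl ⟨he, fun he' => hv ⟨e, he', hev⟩⟩, hev⟩
    · rintro ⟨e, he, hev⟩
      rcases he with he | he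
      · exact ⟨e, he.1, hev⟩
      · exact absurd ⟨e, he.1, hev⟩ hv

theorem IsRotationFor.isMatching {M X : Set (I × J)} (h : G.IsRotationFor M X)
    (hM : G.IsMatching M) : G.IsMatching (M ∆ X) := by
  refine ⟨fun e he => he.elim (fun h => hM.1 h.1) (fun h' => h.subset hM h'.1), ?_⟩
  rintro ⟨m, w⟩ he ⟨m', w'⟩ he' (v | v) hv hv'
  · obtain rfl : m = v := hv
    obtain rfl : m' = m := hv'
    rcases he with he | he <;> rcases he' with he' | he'
    · rw [hM.right_unique he.1 he'.1]
    · exact absurd (h.mem_of_covered_left hM (covered_inl.2 ⟨_, he'.1⟩) he.1) he.2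
    · exact absurd (h.mem_of_covered_left hM (covered_inl.2 ⟨_, he.1⟩) he'.1) he'.2
    · rw [(h.active he.1 he.2).right_unique (h.active he'.1 he'.2)]
  · obtain rfl : w = v := hv
    obtain rfl : w' = w := hv'
    rcases he with he | he <;> rcases he' with he' | he'
    · rw [hM.left_unique he.1 he'.1]
    · exact absurd (h.mem_of_covered_right hM (covered_inr.2 ⟨_, he'.1⟩) he.1) he.2
    · exact absurd (h.mem_of_covered_right hM (covered_inr.2 ⟨_, he.1⟩) he'.1) he'.2
    · rw [h.left_unique hM he.1 he.2 he'.1 he'.2]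

theorem IsRotationFor.rotation_before_symmDiff {M X : Set (I × J)} (h : G.IsRotationFor M X)
    (hM : G.IsMatching M) : G.Before X (M ∆ X) := by
  constructor
  · intro m w w' hw hw'
    rcases hw' with hw' | hw'
    · exact absurd (h.mem_of_covered_left hM (covered_inl.2 ⟨_, hw⟩) hw'.1) hw'.2
    · rcases h.mem_or_active hw with hw | hw
      · exact (h.before hM).left hw hw'.1
      · exact Or.inl (by rw [hw.right_unique (h.active hw'.1 hw'.2)])
  · intro w m m' hm hm'
    rcases hm' with hm' | hm'
    · exact absurd (h.mem_of_covered_right hM (covered_inr.2 ⟨_, hm⟩) hm'.1) hm'.2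
    · by_cases hmM : (m, w) ∈ M
      · exact (h.before hM).right hmM hm'.1
      · exact Or.inl (by rw [h.left_unique hM hm hmM hm'.1 hm'.2])

/-- If the partner in `I` of an edge keeps its edge, admissibility for the later matching implies
admissibility for the earlier one. -/
theorem IsRotationFor.admissible_of_symmDiff {M X : Set (I × J)} (h : G.IsRotationFor M X)
    (hM : G.IsMatching M) {m : I} {w : J} (hm : ¬ Covered X (Sum.inl m))
    (ha : G.Admissible (M ∆ X) (m, w)) : G.Admissible M (m, w) := by
  have hM' := h.isMatching hM
  obtain ⟨hE, hn, ⟨⟨m₁, w₁⟩, he, rfl, hlt⟩, hw⟩ := ha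
  have heM : (m₁, w₁) ∈ M := he.elim (fun h => h.1)
    fun h => absurd (covered_inl.2 ⟨_, h.1⟩) hm
  have hnM : (m₁, w) ∉ M := fun hmem => hn
    (Or.inl ⟨hmem, fun hX => hm (covered_inl.2 ⟨_, hX⟩)⟩)
  refine ⟨hE, hnM, ⟨_, heM, rfl, hlt⟩, ?_⟩
  rcases hw with hw | ⟨⟨m₂, w₂⟩, he₂, rfl, hlt₂⟩
  · exact Or.inl fun h' => hw ((h.covered_iff hM _).1 h')
  · obtain ⟨m₃, h₃⟩ := covered_inr.1 ((h.covered_iff hM _).2 (covered_inr.2 ⟨_, he₂⟩))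
    exact Or.inr ⟨_, h₃, rfl, lt_of_lt_of_le hE (hM'.1 he₂) (hM.1 h₃) rfl rfl rfl hlt₂
      ((h.before_symmDiff hM).right h₃ he₂)⟩

/-- Exchanging the edges along a rotation preserves stability. -/
theorem IsRotationFor.isStable {M X : Set (I × J)} (h : G.IsRotationFor M X)
    (hM : G.IsStable M) : G.IsStable (M ∆ X) := by
  have hM' := h.isMatching hM.1
  refine ⟨hM', ?_⟩
  rintro ⟨m, w⟩ ⟨hE, hn, hb⟩
  -- Vertices of `J` only improve in the exchange, so an edge acceptable to `w` afterwards was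
  -- acceptable before. Stability of `M` then puts the blame on `m`.
  have hw : ¬ Covered M (Sum.inr w) ∨
      ∃ e' ∈ M, Inc e' (Sum.inr w) ∧ G.lt (Sum.inr w) (m, w) e' := by
    rcases hb (Sum.inr w) rfl with hw | ⟨⟨m₂, w₂⟩, he₂, rfl, hlt₂⟩
    · exact Or.inl fun h' => hw ((h.covered_iff hM.1 _).1 h')
    · obtain ⟨m₃, h₃⟩ := covered_inr.1 ((h.covered_iff hM.1 _).2 (covered_inr.2 ⟨_, he₂⟩))
      exact Or.inr ⟨_, h₃, rfl, lt_of_lt_of_le hE (hM'.1 he₂) (hM.1.1 h₃) rfl rfl rfl hlt₂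
        ((h.before_symmDiff hM.1).right h₃ he₂)⟩
  have hnM : (m, w) ∉ M := by
    intro hmem
    rcases hw with hw | ⟨⟨m₂, w₂⟩, he₂, rfl, hlt₂⟩
    · exact hw (covered_inr.2 ⟨_, hmem⟩)
    · rw [hM.1.left_unique hmem he₂] at hlt₂
      exact lt_irrefl (v := Sum.inr w₂) (hM.1.1 he₂) rfl hlt₂
  have hnb : ¬ (¬ Covered M (Sum.inl m) ∨
      ∃ e' ∈ M, Inc e' (Sum.inl m) ∧ G.lt (Sum.inl m) (m, w) e') := by
    intro hm
    refine hM.2 (m, w) ⟨hE, hnM, ?_⟩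
    rintro (v | v) hv
    · obtain rfl : m = v := hv
      exact hm
    · obtain rfl : w = v := hv
      exact hw
  push Not at hnb
  obtain ⟨hcov, hnb⟩ := hnb
  obtain ⟨w₁, h₁⟩ := covered_inl.1 hcov
  rcases hb (Sum.inl m) rfl with hm | ⟨⟨m₂, w₂⟩, he₂, rfl, hlt₂⟩
  · exact hm ((h.covered_iff hM.1 _).1 hcov)
  rcases he₂ with he₂ | he₂
  · exact hnb _ he₂.1 rfl hlt₂
  -- The new edge at `m₂` is active for `M`, so no edge admissible for `M` can be better.
  · have hadm : G.Admissible M (m₂, w) := by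
      refine ⟨hE, hnM, ⟨_, h₁, rfl, ?_⟩, hw⟩
      rcases lt_total (v := Sum.inl m₂) (hM.1.1 h₁) hE rfl rfl with (h' | h') | h'
      · exact absurd (h' ▸ h₁) hnM
      · exact h'
      · exact absurd h' (hnb _ h₁ rfl)
    have hact := h.active he₂.1 he₂.2
    exact not_lt_of_le (v := Sum.inl m₂) hact.1.1 hE rfl rfl (hact.2 _ hadm rfl) hlt₂

/-- The matching `M` determines both edges of a rotation at a vertex of `I` and its matching edge at
a vertex of `J`. So a cycle that meets `Y` in `I` never leaves it. -/
theorem IsRotationFor.covered_left_subset {M X Y : Set (I × J)} (hX : G.IsRotationFor M X)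
    (hY : G.IsRotationFor M Y) (hM : G.IsMatching M) {m : I}
    (hmX : Covered X (Sum.inl m)) (hmY : Covered Y (Sum.inl m)) : X ⊆ Y := by
  have key : ∀ m, Covered Y (Sum.inl m) → ∀ w, (m, w) ∈ X → (m, w) ∈ Y := by
    intro m hm w hw
    rcases hX.mem_or_active hw with hw | hw
    · exact hY.mem_of_covered_left hM hm hw
    · obtain ⟨-, w', -, h₁, h₂⟩ := hY.exists_edges_left hM hm
      rwa [hw.right_unique h₂]
  rintro ⟨m', w⟩ h'
  refine key m' ?_ w h'
  refine hX.subset_of_closed hM (K := {m | Covered Y (Sum.inl m)}) ?_ hmY hmX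
    (covered_inl.2 ⟨_, h'⟩)
  intro m hm m' w hw _ _ hm'
  exact covered_inl.2 ⟨w, hY.mem_of_covered_right hM (covered_inr.2 ⟨m, key m hm w hw⟩) hm'⟩

/-- Two rotations for the same matching are equal or disjoint. -/
theorem IsRotationFor.eq_of_shareVertex {M X Y : Set (I × J)} (hX : G.IsRotationFor M X)
    (hY : G.IsRotationFor M Y) (hM : G.IsMatching M) (h : ShareVertex X Y) : X = Y := by
  obtain ⟨m, hmX, hmY⟩ : ∃ m : I, Covered X (Sum.inl m) ∧ Covered Y (Sum.inl m) := by
    obtain ⟨v | w, h₁, h₂⟩ := h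
    · exact ⟨v, h₁, h₂⟩
    · obtain ⟨m, hm⟩ := hX.exists_matching_right hM h₁
      exact ⟨m, covered_inl.2 ⟨_, hm.1⟩,
        covered_inl.2 ⟨_, hY.mem_of_covered_right hM h₂ hm.2⟩⟩
  exact (hX.covered_left_subset hY hM hmX hmY).antisymm (hY.covered_left_subset hX hM hmY hmX)

/-- A rotation for `M` remains one after exchanging the edges along a disjoint rotation. -/
theorem IsRotationFor.symmDiff {M X Y : Set (I × J)} (hX : G.IsRotationFor M X)
    (hY : G.IsRotationFor M Y) (hM : G.IsMatching M) (h : ¬ ShareVertex X Y) :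
    G.IsRotationFor (M ∆ Y) X := by
  refine hX.transfer ?_
  rintro ⟨m, w⟩ he
  have hm : Covered X (Sum.inl m) := covered_inl.2 ⟨_, he⟩
  have hw : Covered X (Sum.inr w) := covered_inr.2 ⟨_, he⟩
  have hmY : ¬ Covered Y (Sum.inl m) := fun h' => h ⟨_, hm, h'⟩
  refine (hX.mem_or_active he).imp
    (mem_symmDiff_iff_left h hm).2 fun hact => ?_
  obtain ⟨⟨hE, hn, ⟨⟨m₁, w₁⟩, he₁, rfl, hlt⟩, hw'⟩, hbest⟩ := hact
  refine ⟨⟨hE, fun h' => hn ((mem_symmDiff_iff_left h hm).1 h'),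
    ⟨_, (mem_symmDiff_iff_left h hm).2 he₁, rfl, hlt⟩, ?_⟩, ?_⟩
  · rcases hw' with hw' | ⟨⟨m₂, w₂⟩, he₂, rfl, hlt₂⟩
    · exact absurd (hX.covered hM hw).1 hw'
    · exact Or.inr ⟨_, (mem_symmDiff_iff_right h hw).2 he₂, rfl,
        hlt₂⟩
  · rintro ⟨m', w'⟩ ha' rfl
    exact hbest _ (hY.admissible_of_symmDiff hM hmY ha') rfl

/-- If a rotation for `M ∆ X` is disjoint from the rotation `X` for `M` and not a rotation for `M`,
then some edge is admissible for `M`, and better than an active edge of `Y`, but spoiled by `X`. -/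
theorem IsRotationFor.of_symmDiff_or_exists {M X Y : Set (I × J)} (hX : G.IsRotationFor M X)
    (hM : G.IsMatching M) (hY : G.IsRotationFor (M ∆ X) Y) (h : ¬ ShareVertex X Y) :
    G.IsRotationFor M Y ∨ ∃ (m v m' : I) (w w' w'' : J),
      ((m, w) ∈ X ∧ (m, w) ∈ M) ∧ ((v, w) ∈ X ∧ (v, w) ∉ M) ∧
      ((m', w') ∈ Y ∧ (m', w') ∈ M ∆ X) ∧ ((m', w'') ∈ Y ∧ (m', w'') ∉ M ∆ X) ∧
      (m', w) ∈ G.E ∧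
      G.lt (Sum.inl m') (m', w') (m', w) ∧ G.lt (Sum.inl m') (m', w) (m', w'') ∧
      G.lt (Sum.inr w) (v, w) (m', w) ∧ G.lt (Sum.inr w) (m', w) (m, w) := by
  refine or_iff_not_imp_left.2 fun hnot => ?_
  have hM' := hX.isMatching hM
  have hsymm : ¬ ShareVertex Y X := fun ⟨v, h₁, h₂⟩ => h ⟨v, h₂, h₁⟩
  have hsub : ∃ e ∈ Y, ¬ (e ∈ M ∨ G.Active M e) := by
    by_contra! hcon
    exact hnot (hY.transfer hcon)
  obtain ⟨⟨m', w''⟩, hYmem, hna⟩ := hsub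
  push Not at hna
  have hm' : Covered Y (Sum.inl m') := covered_inl.2 ⟨_, hYmem⟩
  have hm'X : ¬ Covered X (Sum.inl m') := fun h' => h ⟨_, h', hm'⟩
  have hn' : (m', w'') ∉ M ∆ X := fun h' => hna.1
    ((mem_symmDiff_iff_left hsymm hm').1 h')
  have hact := hY.active hYmem hn'
  have hadm := hX.admissible_of_symmDiff hM hm'X hact.1
  obtain ⟨w', -, ⟨hw'Y, hw'M⟩, -⟩ := hY.exists_edges_left hM' hm'
  have hw'M₀ := (mem_symmDiff_iff_left hsymm hm').1 hw'M
  -- The active edge of `Y` at `m'` is already admissible for `M`; it can fail to be active only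
  -- because of a better admissible edge $b$.
  have hbetter : ∃ a', G.Admissible M a' ∧ a'.1 = m' ∧ ¬ G.le (Sum.inl m') (m', w'') a' := by
    by_contra! hcon
    exact hna.2 ⟨hadm, fun a' h₁ h₂ => hcon a' h₁ h₂⟩
  obtain ⟨⟨m₁, w⟩, hb, rfl, hlt⟩ := hbetter
  replace hlt := (lt_total (v := Sum.inl m₁) hadm.1 hb.1 rfl rfl).resolve_left hlt
  obtain ⟨hbE, hbM, ⟨⟨m₂, w₂⟩, he₂, rfl, hlt₂⟩, hbw⟩ := hb
  obtain rfl := hM.right_unique hw'M₀ he₂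
  have hbM' : (m₂, w) ∉ M ∆ X := fun h' => hbM
    ((mem_symmDiff_iff_left hsymm hm').1 h')
  -- After the exchange $b$ is no longer admissible. Nothing has changed at its endpoint in `I`, so
  -- its endpoint in `J` must have improved and lies on `X`.
  have hnadm : ¬ (¬ Covered (M ∆ X) (Sum.inr w) ∨
      ∃ e' ∈ M ∆ X, Inc e' (Sum.inr w) ∧ G.lt (Sum.inr w) (m₂, w) e') := fun h' =>
    not_lt_of_le (v := Sum.inl m₂) hadm.1 hbE rfl rfl
      (hact.2 _ ⟨hbE, hbM', ⟨_, hw'M, rfl, hlt₂⟩, h'⟩ rfl) hlt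
  push Not at hnadm
  obtain ⟨hcov, hnlt⟩ := hnadm
  rcases hbw with hbw | ⟨⟨m, w₃⟩, he₃, rfl, hlt₃⟩
  · exact absurd ((hX.covered_iff hM _).2 hcov) hbw
  have hwX : Covered X (Sum.inr w₃) := by
    by_contra hwX
    exact hnlt _ (Or.inl ⟨he₃, fun h' => hwX (covered_inr.2 ⟨_, h'⟩)⟩) rfl hlt₃
  obtain ⟨m₄, v, ⟨h₄, h₄'⟩, ⟨hv, hvact⟩, -⟩ := hX.exists_edges_right hM hwX
  obtain rfl := hM.left_unique h₄' he₃
  refine ⟨m₄, v, m₂, w₃, w', w'', ⟨h₄, he₃⟩, ⟨hv, hvact.1.2.1⟩, ⟨hw'Y, hw'M⟩, ⟨hYmem, hn'⟩, hbE,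
    hlt₂, hlt, ?_, hlt₃⟩
  rcases lt_total (v := Sum.inr w₃) hvact.1.1 hbE rfl rfl with (h' | h') | h'
  · obtain rfl : v = m₂ := congrArg Prod.fst h'
    exact absurd (covered_inl.2 ⟨_, hv⟩) hm'X
  · exact h'
  · exact absurd h' (hnlt _ (Or.inr ⟨hv, hvact.1.2.1⟩) rfl)

end Finite

/-! ### Uniqueness of the extreme stable matchings -/

/-- At a vertex covered by both matchings, the two extremality conditions force equal edges. An edge
of `A` with both endpoints uncovered by `B` would block `B`. -/
theorem IsMin.subset {A B : Set (I × J)} (hA : G.IsMin A) (hB : G.IsMin B) : A ⊆ B := by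
  rintro ⟨m, w⟩ he
  by_contra hn
  by_cases hm : Covered B (Sum.inl m)
  · obtain ⟨w', hw'⟩ := covered_inl.1 hm
    have h₁ := (hA.2 B hB.1 _ he _ hw').1 m rfl rfl
    have h₂ := (hB.2 A hA.1 _ hw' _ he).1 m rfl rfl
    rw [le_antisymm (v := Sum.inl m) (hA.1.1.1 he) (hB.1.1.1 hw') rfl rfl h₁ h₂] at hn
    exact hn hw'
  by_cases hw : Covered B (Sum.inr w)
  · obtain ⟨m', hm'⟩ := covered_inr.1 hw
    have h₁ := (hA.2 B hB.1 _ he _ hm').2 w rfl rfl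
    have h₂ := (hB.2 A hA.1 _ hm' _ he).2 w rfl rfl
    rw [le_antisymm (v := Sum.inr w) (hA.1.1.1 he) (hB.1.1.1 hm') rfl rfl h₂ h₁] at hn
    exact hn hm'
  refine hB.1.2 (m, w) ⟨hA.1.1.1 he, hn, ?_⟩
  rintro (v | v) rfl
  exacts [Or.inl hm, Or.inl hw]

theorem IsMax.subset {A B : Set (I × J)} (hA : G.IsMax A) (hB : G.IsMax B) : A ⊆ B := by
  rintro ⟨m, w⟩ he
  by_contra hn
  by_cases hm : Covered B (Sum.inl m)
  · obtain ⟨w', hw'⟩ := covered_inl.1 hm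
    have h₁ := (hA.2 B hB.1 _ he _ hw').1 m rfl rfl
    have h₂ := (hB.2 A hA.1 _ hw' _ he).1 m rfl rfl
    rw [le_antisymm (v := Sum.inl m) (hA.1.1.1 he) (hB.1.1.1 hw') rfl rfl h₂ h₁] at hn
    exact hn hw'
  by_cases hw : Covered B (Sum.inr w)
  · obtain ⟨m', hm'⟩ := covered_inr.1 hw
    have h₁ := (hA.2 B hB.1 _ he _ hm').2 w rfl rfl
    have h₂ := (hB.2 A hA.1 _ hm' _ he).2 w rfl rfl
    rw [le_antisymm (v := Sum.inr w) (hA.1.1.1 he) (hB.1.1.1 hm') rfl rfl h₁ h₂] at hn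
    exact hn hm'
  refine hB.1.2 (m, w) ⟨hA.1.1.1 he, hn, ?_⟩
  rintro (v | v) rfl
  exacts [Or.inl hm, Or.inl hw]

/-! ### Chains of rotations -/

/-- Starting from `M` and exchanging successively the edges along the members of the list, each of
them a rotation for the current matching, one arrives at `M'`. -/
def Chain (G : PrefGraph I J) : Set (I × J) → List (Set (I × J)) → Set (I × J) → Prop
  | M, [], M' => M = M'
  | M, X :: l, M' => G.IsRotationFor M X ∧ Chain G (M ∆ X) l M'

theorem chain_cons {M M' X : Set (I × J)} {l : List (Set (I × J))} :
    G.Chain M (X :: l) M' ↔ G.IsRotationFor M X ∧ G.Chain (M ∆ X) l M' := Iff.rfl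

theorem chain_append {M M' : Set (I × J)} {l l' : List (Set (I × J))} :
    G.Chain M (l ++ l') M' ↔ ∃ L, G.Chain M l L ∧ G.Chain L l' M' := by
  induction l generalizing M with
  | nil => simp [Chain]
  | cons X l ih => simp [chain_cons, ih, and_assoc]

theorem Chain.eq_foldl {M M' : Set (I × J)} {l : List (Set (I × J))} (h : G.Chain M l M') :
    M' = l.foldl (· ∆ ·) M := by
  induction l generalizing M with
  | nil => exact h.symm
  | cons X l ih => exact ih h.2

theorem IsRotationFor.shareVertex_self {M X : Set (I × J)} (hX : G.IsRotationFor M X) :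
    ShareVertex X X := by
  obtain ⟨m, w, h⟩ := hX.nonempty
  exact ⟨Sum.inl m, ⟨_, h, rfl⟩, ⟨_, h, rfl⟩⟩

section Finite

variable [Finite I] [Finite J]

theorem Chain.isStable {M M' : Set (I × J)} {l : List (Set (I × J))} (h : G.Chain M l M')
    (hM : G.IsStable M) : G.IsStable M' := by
  induction l generalizing M with
  | nil => exact h ▸ hM
  | cons X l ih => exact ih h.2 (h.1.isStable hM)

theorem Chain.covered_iff {M M' : Set (I × J)} {l : List (Set (I × J))} (h : G.Chain M l M')
    (hM : G.IsStable M) (v : I ⊕ J) : Covered M v ↔ Covered M' v := by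
  induction l generalizing M with
  | nil => exact h ▸ Iff.rfl
  | cons X l ih => exact (h.1.covered_iff hM.1 v).trans (ih h.2 (h.1.isStable hM))

theorem Chain.before {M M' : Set (I × J)} {l : List (Set (I × J))} (h : G.Chain M l M')
    (hM : G.IsStable M) : G.Before M M' := by
  induction l generalizing M with
  | nil => exact h ▸ hM.1.before_self
  | cons X l ih =>
    have hX := h.1.isStable hM
    exact (h.1.before_symmDiff hM.1).trans hM.1.1 hX.1.1 (h.2.isStable hX).1.1 (ih h.2 hX)
      fun v hv _ => (h.1.covered_iff hM.1 v).1 hv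

/-- A member of a chain has its edges in the graph, its vertices are covered by the two ends
of the chain, and it lies between them. -/
theorem Chain.of_mem {M M' X : Set (I × J)} {l : List (Set (I × J))} (h : G.Chain M l M')
    (hM : G.IsStable M) (hX : X ∈ l) :
    X ⊆ G.E ∧ (∀ v, Covered X v → Covered M v) ∧ G.Before M X ∧ G.Before X M' := by
  obtain ⟨p, s, rfl⟩ := List.append_of_mem hX
  obtain ⟨L, h₁, h₂, h₃⟩ := chain_append.1 h
  have hL := h₁.isStable hM
  have hL' := h₂.isStable hL
  have hsub := h₂.subset hL.1
  have hcov : ∀ v, Covered X v → Covered L v ∧ Covered (L ∆ X) v := fun v => h₂.covered hL.1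
  exact ⟨hsub, fun v hv => (h₁.covered_iff hM v).2 (hcov v hv).1,
    (h₁.before hM).trans hM.1.1 hL.1.1 hsub (h₂.before hL.1) fun v _ hv => (hcov v hv).1,
    (h₂.rotation_before_symmDiff hL.1).trans hsub hL'.1.1 (h₃.isStable hL').1.1 (h₃.before hL')
      fun v hv _ => (hcov v hv).2⟩

theorem Chain.pairwise {M M' : Set (I × J)} {l : List (Set (I × J))} (h : G.Chain M l M')
    (hM : G.IsStable M) : l.Pairwise G.Before := by
  induction l generalizing M with
  | nil => exact List.Pairwise.nil
  | cons X l ih =>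
    have hX := h.1.isStable hM
    refine List.Pairwise.cons (fun Y hY => ?_) (ih h.2 hX)
    obtain ⟨h₁, h₂, h₃, -⟩ := h.2.of_mem hX hY
    exact (h.1.rotation_before_symmDiff hM.1).trans (h.1.subset hM.1) hX.1.1 h₁ h₃
      fun v hv _ => (h.1.covered hM.1 hv).2

/-- If both comparisons held, the two distinct edges of `X` at a common vertex would both equal any
edge of `Y` there. -/
theorem IsRotationFor.not_before {M X Y : Set (I × J)} (hX : G.IsRotationFor M X)
    (hM : G.IsMatching M) (hY : Y ⊆ G.E) (hs : ShareVertex X Y) (h : G.Before X Y) :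
    ¬ G.Before Y X := by
  intro h'
  have hXE := hX.subset hM
  obtain ⟨m | w, h₁, h₂⟩ := hs
  · obtain ⟨w₁, w₂, ⟨h₃, h₄⟩, h₅, h₆⟩ := hX.exists_edges_left hM h₁
    obtain ⟨w₃, h₇⟩ := covered_inl.1 h₂
    have e₁ := le_antisymm (v := Sum.inl m) (hXE h₃) (hY h₇) rfl rfl (h.left h₃ h₇) (h'.left h₇ h₃)
    have e₂ := le_antisymm (v := Sum.inl m) (hXE h₅) (hY h₇) rfl rfl (h.left h₅ h₇) (h'.left h₇ h₅)
    exact h₆.1.2.1 (by rwa [e₂, ← e₁])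
  · obtain ⟨m₁, m₂, ⟨h₃, h₄⟩, ⟨h₅, h₆⟩, -⟩ := hX.exists_edges_right hM h₁
    obtain ⟨m₃, h₇⟩ := covered_inr.1 h₂
    have e₁ := le_antisymm (v := Sum.inr w) (hXE h₃) (hY h₇) rfl rfl (h'.right h₇ h₃) (h.right h₃ h₇)
    have e₂ := le_antisymm (v := Sum.inr w) (hXE h₅) (hY h₇) rfl rfl (h'.right h₇ h₅) (h.right h₅ h₇)
    exact h₆.1.2.1 (by rwa [e₂, ← e₁])

/-- Maximality would put `M ∆ X` before `M`, closing the circle `X`, `M ∆ X`, `M`, `X`. -/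
theorem IsMax.not_isRotationFor {M X : Set (I × J)} (hM : G.IsMax M) :
    ¬ G.IsRotationFor M X := by
  intro h
  have hM₁ := hM.1.1
  have hbefore : G.Before (M ∆ X) M := by
    constructor
    · exact fun h₁ h₂ => (hM.2 _ (h.isStable hM.1) _ h₂ _ h₁).1 _ rfl rfl
    · exact fun h₁ h₂ => (hM.2 _ (h.isStable hM.1) _ h₂ _ h₁).2 _ rfl rfl
  have hXE := h.subset hM₁
  have hM' := (h.isMatching hM₁).1
  have h' : G.Before X X :=
    ((h.rotation_before_symmDiff hM₁).trans hXE hM' hM₁.1 hbefore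
      fun v hv _ => (h.covered hM₁ hv).2).trans hXE hM₁.1 hXE (h.before hM₁)
      fun v hv _ => (h.covered hM₁ hv).1
  exact h.not_before hM₁ hXE h.shareVertex_self h' h'

open Classical in
/-- A rotation for the first matching of a chain to `M_max` occurs in the chain and can be moved to
its front. -/
theorem Chain.erase {M B X : Set (I × J)} {l : List (Set (I × J))} (h : G.Chain M l B)
    (hM : G.IsStable M) (hB : G.IsMax B) (hX : G.IsRotationFor M X) :
    X ∈ l ∧ G.Chain (M ∆ X) (l.erase X) B := by
  induction l generalizing M with
  | nil =>
    obtain rfl : M = B := h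
    exact absurd hX hB.not_isRotationFor
  | cons Y l ih =>
    by_cases hXY : X = Y
    · subst hXY
      simpa using h.2
    -- Distinct rotations for `M` are disjoint, so `X` survives the exchange along `Y` and the two
    -- exchanges commute.
    have hs : ¬ ShareVertex X Y := fun hs => hXY (hX.eq_of_shareVertex h.1 hM.1 hs)
    have hs' : ¬ ShareVertex Y X := fun ⟨v, h₁, h₂⟩ => hs ⟨v, h₂, h₁⟩
    obtain ⟨h₁, h₂⟩ := ih h.2 (h.1.isStable hM) (hX.symmDiff h.1 hM.1 hs)
    refine ⟨List.mem_cons_of_mem _ h₁, ?_⟩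
    rw [List.erase_cons_tail (by simpa using Ne.symm hXY)]
    exact ⟨h.1.symmDiff hX hM.1 hs', by rwa [symmDiff_right_comm]⟩

open Classical in
/-- Any two chains from a stable matching to `M_max` consist of the same rotations. -/
theorem Chain.perm {M B : Set (I × J)} {l l' : List (Set (I × J))} (h : G.Chain M l B)
    (h' : G.Chain M l' B) (hM : G.IsStable M) (hB : G.IsMax B) : l.Perm l' := by
  induction l generalizing M l' with
  | nil =>
    obtain rfl : M = B := h
    cases l' with
    | nil => rfl
    | cons Y l' => exact absurd h'.1 hB.not_isRotationFor
  | cons X l ih =>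
    obtain ⟨h₁, h₂⟩ := h'.erase hM hB h.1
    exact ((ih h.2 h₂ (h.1.isStable hM)).cons X).trans (List.perm_cons_erase h₁).symm

end Finite

/-! ### Traces as lists of rotations -/

/-- The list is the sequence of rotations of a trace. -/
def IsTraceList (G : PrefGraph I J) (l : List (Set (I × J))) : Prop :=
  ∃ A B, G.IsMin A ∧ G.IsMax B ∧ G.Chain A l B

theorem chain_ofFn {N : ℕ} {M : Fin (N + 1) → Set (I × J)} {C : Fin N → Set (I × J)}
    (h : ∀ i : Fin N, G.IsRotationFor (M i.castSucc) (C i) ∧ M i.succ = M i.castSucc ∆ C i) :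
    G.Chain (M 0) (List.ofFn C) (M (Fin.last N)) := by
  induction N with
  | zero => simp [Chain]
  | succ N ih =>
    rw [List.ofFn_succ]
    refine ⟨(h 0).1, ?_⟩
    have := ih (M := fun i => M i.succ) (C := fun i => C i.succ) fun i => h i.succ
    rw [← Fin.succ_last, ← Fin.castSucc_zero, ← (h 0).2]
    exact this

theorem IsTrace.isTraceList {N : ℕ} {M : Fin (N + 1) → Set (I × J)} {C : Fin N → Set (I × J)}
    (h : G.IsTrace N M C) : G.IsTraceList (List.ofFn C) :=
  ⟨_, _, h.1, h.2.1, chain_ofFn h.2.2.2⟩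

/-- No general existence result for traces is required: a rotation in `G.rotations` comes with a
trace. -/
theorem exists_isTraceList (X : G.rotations) : ∃ l, G.IsTraceList l := by
  obtain ⟨N, M, C, hC, -⟩ := X.2
  exact ⟨_, hC.isTraceList⟩

section Finite

variable [Finite I] [Finite J]

theorem IsTraceList.exists_isTrace {l : List (Set (I × J))} (h : G.IsTraceList l) :
    ∃ M, G.IsTrace l.length M fun i => l[i] := by
  obtain ⟨A, B, hA, hB, h⟩ := h
  have hsplit : ∀ i, ∃ L, G.Chain A (l.take i) L ∧ G.Chain L (l.drop i) B := fun i => by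
    rwa [← chain_append, List.take_append_drop]
  -- The `i`-th matching is recovered from the first `i` rotations.
  refine ⟨fun i => (l.take i).foldl (· ∆ ·) A, by simpa using hA, ?_, fun i => ?_, fun i => ?_⟩
  · simpa [← h.eq_foldl] using hB
  · obtain ⟨L, h₁, -⟩ := hsplit i
    dsimp only
    rw [← h₁.eq_foldl]
    exact h₁.isStable hA.1
  · obtain ⟨L, h₁, h₂⟩ := hsplit i
    rw [List.drop_eq_getElem_cons i.2] at h₂
    simp only [Fin.val_castSucc, Fin.val_succ]
    rw [← List.take_concat_get' _ _ i.2, List.foldl_append, ← h₁.eq_foldl]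
    exact ⟨h₂.1, rfl⟩

theorem IsTraceList.perm {l l' : List (Set (I × J))} (h : G.IsTraceList l)
    (h' : G.IsTraceList l') : l.Perm l' := by
  obtain ⟨A, B, hA, hB, h⟩ := h
  obtain ⟨A', B', hA', hB', h'⟩ := h'
  obtain rfl := (hA.subset hA').antisymm (hA'.subset hA)
  obtain rfl := (hB.subset hB').antisymm (hB'.subset hB)
  exact h.perm h' hA.1 hB

theorem IsTraceList.mem_rotations {l : List (Set (I × J))} (h : G.IsTraceList l)
    {X : Set (I × J)} : X ∈ G.rotations ↔ X ∈ l := by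
  constructor
  · rintro ⟨N, M, C, hC, i, rfl⟩
    exact (hC.isTraceList.perm h).mem_iff.1 (by simp)
  · intro hX
    obtain ⟨M, hM⟩ := h.exists_isTrace
    obtain ⟨i, hi, rfl⟩ := List.getElem_of_mem hX
    exact ⟨_, _, _, hM, ⟨i, hi⟩, rfl⟩

theorem precedes_iff {X Y : G.rotations} : G.Precedes X Y ↔ ∀ l, G.IsTraceList l →
    ∃ (i j : ℕ) (hi : i < l.length) (hj : j < l.length), i < j ∧ l[i] = X.1 ∧ l[j] = Y.1 := by
  constructor
  · intro h l hl
    obtain ⟨M, hM⟩ := hl.exists_isTrace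
    obtain ⟨i, j, hij, hX, hY⟩ := h _ _ _ hM
    exact ⟨i, j, i.2, j.2, hij, hX, hY⟩
  · intro h N M C hC
    obtain ⟨i, j, hi, hj, hij, hX, hY⟩ := h _ hC.isTraceList
    refine ⟨⟨i, by simpa using hi⟩, ⟨j, by simpa using hj⟩, hij, ?_, ?_⟩
    · simpa using hX
    · simpa using hY

theorem IsTraceList.pairwise {l : List (Set (I × J))} (h : G.IsTraceList l) :
    l.Pairwise G.Before := by
  obtain ⟨A, B, hA, hB, h⟩ := h
  exact h.pairwise hA.1

theorem IsTraceList.exists_isRotationFor {l : List (Set (I × J))} (h : G.IsTraceList l)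
    {X : Set (I × J)} (hX : X ∈ l) : ∃ M, G.IsMatching M ∧ G.IsRotationFor M X := by
  obtain ⟨A, B, hA, hB, h⟩ := h
  obtain ⟨p, s, rfl⟩ := List.append_of_mem hX
  obtain ⟨L, h₁, h₂⟩ := chain_append.1 h
  exact ⟨L, (h₁.isStable hA.1).1, h₂.1⟩

theorem IsTraceList.not_before {l : List (Set (I × J))} (h : G.IsTraceList l)
    {X Y : Set (I × J)} (hX : X ∈ l) (hY : Y ∈ l) (hs : ShareVertex X Y) (hXY : G.Before X Y) :
    ¬ G.Before Y X := by
  obtain ⟨M, hM, hMX⟩ := h.exists_isRotationFor hX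
  obtain ⟨M', hM', hMY⟩ := h.exists_isRotationFor hY
  exact hMX.not_before hM (hMY.subset hM') hs hXY

theorem IsTraceList.nodup {l : List (Set (I × J))} (h : G.IsTraceList l) : l.Nodup := by
  refine h.pairwise.imp_of_mem ?_
  rintro X Y hX hY hXY rfl
  obtain ⟨M, hM, hMX⟩ := h.exists_isRotationFor hX
  exact hMX.not_before hM (hMX.subset hM) hMX.shareVertex_self hXY hXY

/-! ### Forced orders and exchangeable neighbours -/

/-- `Before` does not refer to a trace, yet in each trace it holds from earlier to later rotations,
and at a common vertex only one direction is possible. -/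
theorem precedes_of_shareVertex {X Y : G.rotations} (hs : ShareVertex X.1 Y.1)
    (h : G.Before X.1 Y.1) : G.Precedes X Y := by
  refine precedes_iff.2 fun l hl => ?_
  obtain ⟨i, hi, hX⟩ := List.getElem_of_mem (hl.mem_rotations.1 X.2)
  obtain ⟨j, hj, hY⟩ := List.getElem_of_mem (hl.mem_rotations.1 Y.2)
  refine ⟨i, j, hi, hj, ?_, hX, hY⟩
  have hn := hl.not_before (hl.mem_rotations.1 X.2) (hl.mem_rotations.1 Y.2) hs h
  by_contra! hij
  rcases hij.eq_or_lt with rfl | hij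
  · rw [← hX, ← hY] at hn h
    exact hn h
  · exact hn (hX ▸ hY ▸ List.pairwise_iff_getElem.1 hl.pairwise j i hj hi hij)

theorem Precedes.trans {X Y Z : G.rotations} (h : G.Precedes X Y) (h' : G.Precedes Y Z) :
    G.Precedes X Z := by
  refine precedes_iff.2 fun l hl => ?_
  obtain ⟨i, j, hi, hj, hij, hX, hY⟩ := precedes_iff.1 h l hl
  obtain ⟨i', j', hi', hj', hij', hY', hZ⟩ := precedes_iff.1 h' l hl
  have := (hl.nodup.getElem_inj_iff (hi := hj) (hj := hi')).1 (hY.trans hY'.symm)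
  exact ⟨i, j', hi, hj', by omega, hX, hZ⟩

theorem Precedes.ne {X Y : G.rotations} (h : G.Precedes X Y) : X ≠ Y := by
  rintro rfl
  obtain ⟨l, hl⟩ := exists_isTraceList X
  obtain ⟨i, j, hi, hj, hij, hX, hY⟩ := precedes_iff.1 h l hl
  have := (hl.nodup.getElem_inj_iff (hi := hi) (hj := hj)).1 (hX.trans hY.symm)
  omega

theorem LocalCondition.precedes {X Y : G.rotations} (h : G.LocalCondition X.1 Y.1) :
    G.Precedes X Y := by
  obtain ⟨m, v, m', w, w', w'', ⟨hmw, -⟩, -, ⟨he', -⟩, ⟨ha', -⟩, hbE, -, hlt₁, hlt₂, -, hlt₃⟩ := h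
  refine precedes_iff.2 fun l hl => ?_
  obtain ⟨i, hi, hX⟩ := List.getElem_of_mem (hl.mem_rotations.1 X.2)
  obtain ⟨j, hj, hY⟩ := List.getElem_of_mem (hl.mem_rotations.1 Y.2)
  refine ⟨i, j, hi, hj, ?_, hX, hY⟩
  by_contra! hij
  obtain ⟨A, B, hA, hB, h⟩ := hl
  rw [← List.take_append_drop j l] at h
  obtain ⟨L, h₁, h₂⟩ := chain_append.1 h
  have hL := h₁.isStable hA.1
  have hXmem : X.1 ∈ l.drop j := by
    rw [← hX, List.mem_iff_getElem]
    exact ⟨i - j, by simp; omega, by simp [hij]⟩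
  obtain ⟨hXE, hXcov, hXb, -⟩ := h₂.of_mem hL hXmem
  rw [List.drop_eq_getElem_cons hj, hY] at h₂
  have hrot := h₂.1
  have hYE := hrot.subset hL.1
  -- The hypotheses call $e'$ matching and $a'$ active with respect to some stable matchings, not
  -- `L`. That $m'$ prefers $e'$ to $a'$ shows that they have the same roles for `L`.
  have hlt : G.lt (Sum.inl m') (m', w') (m', w'') :=
    lt_trans (hYE he') hbE (hYE ha') rfl rfl rfl hlt₁ hlt₂
  have ha'L : (m', w'') ∉ L := fun hmem =>
    not_lt_of_le (v := Sum.inl m') (hYE ha') (hYE he') rfl rfl ((hrot.before hL.1).left hmem he') hlt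
  have hact := hrot.active ha' ha'L
  have he'L : (m', w') ∈ L := by
    refine (hrot.mem_or_active he').resolve_right fun hact' => ?_
    rw [hact.right_unique hact'] at hlt
    exact lt_irrefl (v := Sum.inl m') (hYE he') rfl hlt
  obtain ⟨n, hn⟩ := covered_inr.1 (hXcov _ (covered_inr.2 ⟨m, hmw⟩))
  -- As `X` is still to come, `w` holds in `L` an edge no better for it than $e$, hence worse than
  -- $b$.
  have hadm : G.Admissible L (m', w) := by
    refine ⟨hbE, fun hmem => ?_, ⟨_, he'L, rfl, hlt₁⟩, Or.inr ⟨_, hn, rfl,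
      lt_of_lt_of_le hbE (hXE hmw) (hL.1.1 hn) rfl rfl rfl hlt₃ (hXb.right hn hmw)⟩⟩
    rw [hL.1.right_unique hmem he'L] at hlt₁
    exact lt_irrefl (v := Sum.inl m') (hYE he') rfl hlt₁
  exact not_lt_of_le (v := Sum.inl m') (hYE ha') hbE rfl rfl (hact.2 _ hadm rfl) hlt₂

theorem precedes_of_adj {X Y : G.rotations} (h : G.rotationDigraph.Adj X Y) : G.Precedes X Y :=
  h.elim (fun h => h.2) LocalCondition.precedes

/-- Consecutive rotations of a trace that are not joined by an arc can be exchanged. -/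
theorem IsTraceList.swap {p s : List (Set (I × J))} {X Y : G.rotations}
    (h : G.IsTraceList (p ++ X.1 :: Y.1 :: s)) (hXY : ¬ G.rotationDigraph.Adj X Y) :
    G.IsTraceList (p ++ Y.1 :: X.1 :: s) := by
  have hl := h
  obtain ⟨A, B, hA, hB, h⟩ := h
  obtain ⟨L, h₁, h₂, h₃, h₄⟩ := chain_append.1 h
  have hL := h₁.isStable hA.1
  have hL' := h₂.isStable hL
  have hs : ¬ ShareVertex X.1 Y.1 := by
    intro hs
    refine hXY (Or.inl ⟨hs, precedes_of_shareVertex hs ?_⟩)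
    exact (List.pairwise_cons.1 (List.pairwise_append.1 hl.pairwise).2.1).1 _ List.mem_cons_self
  have hs' : ¬ ShareVertex Y.1 X.1 := fun ⟨v, h₁, h₂⟩ => hs ⟨v, h₂, h₁⟩
  rcases h₂.of_symmDiff_or_exists hL.1 h₃ hs with hY |
    ⟨m, v, m', w, w', w'', hmw, hvw, he', ha', hbE, hlt₁, hlt₂, hlt₃, hlt₄⟩
  · refine ⟨A, B, hA, hB, chain_append.2 ⟨L, h₁, hY, h₂.symmDiff hY hL.1 hs, ?_⟩⟩
    rwa [symmDiff_right_comm]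
  · refine absurd (Or.inr ⟨m, v, m', w, w', w'', ⟨hmw.1, L, hL, h₂, hmw.2⟩,
      ⟨hvw.1, L, hL, h₂, hvw.2⟩, ⟨he'.1, _, hL', h₃, he'.2⟩, ⟨ha'.1, _, hL', h₃, ha'.2⟩, hbE,
      fun Z hZ hb => ?_, hlt₁, hlt₂, hlt₃, hlt₄⟩) hXY
    have hm' : Covered Y.1 (Sum.inl m') := covered_inl.2 ⟨_, he'.1⟩
    have ha'E := h₃.subset hL'.1 ha'.1
    have he'E := h₃.subset hL'.1 he'.1
    -- All traces have the same rotations, so this one suffices to see that none contains $b$. At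
    -- $m'$ the rotations before `X` have no edge worse than $e'$, those after `Y` none better than
    -- $a'$, `X` misses $m'$, and `Y` has only $e'$ and $a'$ there.
    rcases List.mem_append.1 (hl.mem_rotations.1 hZ) with hZ | hZ
    · exact not_lt_of_le (v := Sum.inl m') hbE he'E rfl rfl ((h₁.of_mem hA.1 hZ).2.2.2.left hb
        ((mem_symmDiff_iff_left hs' hm').1 he'.2)) hlt₁
    rcases List.mem_cons.1 hZ with rfl | hZ
    · exact hs ⟨_, covered_inl.2 ⟨_, hb⟩, hm'⟩
    rcases List.mem_cons.1 hZ with rfl | hZ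
    · rcases h₃.mem_or_active hb with hb | hb
      · rw [hL'.1.right_unique hb he'.2] at hlt₁
        exact lt_irrefl (v := Sum.inl m') he'E rfl hlt₁
      · rw [hb.right_unique (h₃.active ha'.1 ha'.2)] at hlt₂
        exact lt_irrefl (v := Sum.inl m') ha'E rfl hlt₂
    · exact not_lt_of_le (v := Sum.inl m') ha'E hbE rfl rfl ((h₄.of_mem (h₃.isStable hL') hZ).2.2.1.left
        (Or.inr ha') hb) hlt₂

end Finite

/-! ### Sorting a trace, and the conclusion -/

theorem exists_move_past {α : Type*} {T : List α → Prop} {S : α → Prop}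
    (hswap : ∀ p X Y s, ¬ S X → S Y → T (p ++ X :: Y :: s) → T (p ++ Y :: X :: s))
    (p l s : List α) (X : α) (hX : ¬ S X) (hl : ∀ Y ∈ l, S Y) (h : T (p ++ X :: (l ++ s))) :
    T (p ++ l ++ X :: s) := by
  induction l generalizing p with
  | nil => simpa using h
  | cons Y l ih =>
    have := ih (p ++ [Y]) (fun Z hZ => hl Z (List.mem_cons_of_mem _ hZ))
      (by simpa using hswap p X Y (l ++ s) hX (hl Y List.mem_cons_self) h)
    simpa using this

/-- If `T` is preserved by exchanging consecutive entries of which only the second satisfies `S`,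
then the entries satisfying `S` can be moved to the front. -/
theorem exists_partition {α : Type*} {T : List α → Prop} {S : α → Prop}
    (hswap : ∀ p X Y s, ¬ S X → S Y → T (p ++ X :: Y :: s) → T (p ++ Y :: X :: s))
    (p l : List α) (h : T (p ++ l)) :
    ∃ l₁ l₂, T (p ++ (l₁ ++ l₂)) ∧ (∀ X ∈ l₁, S X) ∧ ∀ X ∈ l₂, ¬ S X := by
  induction l generalizing p with
  | nil => exact ⟨[], [], h, by simp, by simp⟩
  | cons X l ih =>
    obtain ⟨l₁, l₂, h', h₁, h₂⟩ := ih (p ++ [X]) (by simpa using h)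
    by_cases hX : S X
    · exact ⟨X :: l₁, l₂, by simpa using h', by simpa [hX] using h₁, h₂⟩
    · refine ⟨l₁, X :: l₂, ?_, h₁, by simpa [hX] using h₂⟩
      simpa using exists_move_past hswap p l₁ l₂ X hX h₁ (by simpa using h')

theorem precedes_iff_transGen [Finite I] [Finite J] {X Y : G.rotations} :
    G.Precedes X Y ↔ Relation.TransGen G.rotationDigraph.Adj X Y := by
  constructor
  · intro h
    by_contra hn
    have hne := h.ne
    obtain ⟨l, hl⟩ := exists_isTraceList X
    -- No arc enters `S` from outside, so a rotation outside `S` can always be exchanged with a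
    -- member of `S` directly after it.
    let S : Set (I × J) → Prop := fun Z =>
      ∃ hZ : Z ∈ G.rotations, Relation.ReflTransGen G.rotationDigraph.Adj ⟨Z, hZ⟩ Y
    obtain ⟨l₁, l₂, hl', h₁, h₂⟩ := exists_partition (T := G.IsTraceList) (S := S) (by
      intro p Z Z' s hZ hZ' hT
      have hZr : Z ∈ G.rotations := hT.mem_rotations.2 (by simp)
      obtain ⟨hZr', hr⟩ := hZ'
      exact hT.swap (X := ⟨Z, hZr⟩) (Y := ⟨Z', hZr'⟩) fun hadj => hZ ⟨hZr, hr.head hadj⟩) [] l hl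
    rw [List.nil_append] at hl'
    obtain ⟨i, j, hi, hj, hij, hX, hY⟩ := precedes_iff.1 h _ hl'
    -- `Y` itself belongs to `S` by the trivial path, so it lies in the front part, and so does `X`,
    -- which is earlier.
    have hj' : j < l₁.length := by
      by_contra hj'
      rw [List.getElem_append_right (not_lt.1 hj')] at hY
      exact h₂ Y.1 (hY ▸ List.getElem_mem _) ⟨Y.2, .refl⟩
    rw [List.getElem_append_left (hij.trans hj')] at hX
    obtain ⟨_, hr⟩ := h₁ X.1 (hX ▸ List.getElem_mem _)
    exact (Relation.reflTransGen_iff_eq_or_transGen.1 hr).elim (fun e => hne e.symm) hn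
  · intro h
    induction h with
    | single h => exact precedes_of_adj h
    | tail _ h ih => exact ih.trans (precedes_of_adj h)

end PrefGraph

end RotPoset

theorem mainTheorem7 {I J : Type*} [Finite I] [Finite J] (G : RotPoset.PrefGraph I J)
    (C D : G.rotations) :
    (G.Precedes C D ↔ Relation.TransGen G.rotationDigraph.Adj C D) ∧
    ((C = D ∨ G.Precedes C D) ↔ Relation.ReflTransGen G.rotationDigraph.Adj C D) := by
  rw [Relation.reflTransGen_iff_eq_or_transGen, RotPoset.PrefGraph.precedes_iff_transGen,
    eq_comm (a := D)]
  exact ⟨Iff.rfl, Iff.rfl⟩
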